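/- Let $X\subset\mathbb R^d$ be a finite nonempty set of $n$ points with the Euclidean distance, $k\ge 1$ an integer, and $f$ a function that assigns a real number $f(z;X)\ge 0$ to a real $z$ and an instance $X$. For a nonempty $Q\subseteq X$ put $d_{\mathrm{center}}(x;Q)=\min_{q\in Q}\|x-q\|$ and $$\zeta_{k,f}(X)=\max_{\emptyset\ne Q\subseteq X,\ |Q|\le k}\ \max_{x\in X}\ \frac{n\,f(d_{\mathrm{center}}(x;Q);X)}{\sum_{y\in X}f(d_{\mathrm{center}}(y;Q);X)},$$ where a $Q$ for which the denominator is $0$ contributes $0$. *Generic seeding* on $(X,k,f)$ chooses $c_1\in X$ uniformly and then, for $i=2,\dots,k$, chooses $c_i=y\in X$ with probability proportional to $f(d_{\mathrm{center}}(y;\{c_1,\dots,c_{i-1}\});X)$ (uniformly if all these weights are $0$). *MCMC seeding* with parameter $m\ge1$ is run on $mk$ points drawn independently and uniformly with replacement from $X$, no sample being used twice: $c_1$ is one of the samples, and for $i=2,\dots,k$ the centre $c_i$ is obtained from $m$ fresh samples by taking the first one as candidate $x$ and then, for each of the other $m-1$ samples $y$ in turn, replacing $x$ by $y$ with probability $\min\{1,w(y)/w(x)\}$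 (with probability $1$ if $w(x)=0$), where $w(\cdot)=f(d_{\mathrm{center}}(\cdot;\{c_1,\dots,c_{i-1}\});X)$; the final $x$ is $c_i$. Centres $c_1,\dots,c_k$ induce a partition of $X$ into $k$ (possibly empty) clusters by assigning every point to a nearest centre, ties being broken by an arbitrary fixed rule, the same for both algorithms. For $k$-clusterings $\mathcal C=(C_1,\dots,C_k)$ and $\mathcal G=(G_1,\dots,G_k)$ of $X$ (partitions into $k$ disjoint, possibly empty, labelled sets) the cost of $\mathcal C$ with respect to $\mathcal G$ is $$\mathrm{cost}_{\mathcal G}(\mathcal C)=\frac1n\min_{\sigma\in\Sigma_k}\sum_{x\in X}\sum_{j=1}^k\mathbf 1\{x\in C_{\sigma(j)},\ x\notin G_j\}.$$ **Theorem.** (1) There is an absolute constant $C>0$ such that for all $d,X,k,f$ as above, all $\epsilon>0$, every integer $m\ge 1$ with $m\ge C\,\zeta_{k,f}(X)\log(k/\epsilon)$, every tie-breaking rule and every ground-truth $k$-clustering $\mathcal G$ of $X$, $$\bigl|\,\mathbb E[\mathrm{cost}_{\mathcal G}(S')]-\mathbb E[\mathrm{cost}_{\mathcal G}(S)]\,\bigr|\le\epsilon,$$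 where $S$ and $S'$ are the partitions of $X$ induced by the centres of generic seeding and of MCMC seeding, respectively. (2) There is an absolute constant $C>0$ such that for all $d,X,k$ as above, all $\epsilon'>0$ and $\delta\in(0,1)$, and every given $k$-clustering $S'$ of $X$ (in particular the one induced by MCMC seeding), there is a randomized estimator that makes at most $C\,k\,\epsilon'^{-2}\log(1/\delta)$ ground-truth queries (each reveals, for a chosen $x\in X$, the index $j$ with $x\in G_j$) and such that, for every ground-truth $k$-clustering $\mathcal G$ of $X$, its output is within $\epsilon'$ of $\mathrm{cost}_{\mathcal G}(S')$ with probability at least $1-\delta$. -/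

import Mathlib

open scoped NNReal ENNReal

noncomputable section

namespace Seeding

/-- The points live in `ℝ^d` with the Euclidean distance. -/
abbrev Pt (d : ℕ) : Type := EuclideanSpace ℝ (Fin d)

variable {d : ℕ}

/-- The weight `f(d_center(y; Q); X)` of the point `y`, where `d_center(y; Q)` is the distance from
`y` to the nearest centre in `Q` (`Q` is always nonempty and finite below, so that the infimum
distance is a minimum). -/
def weight (f : ℝ → Finset (Pt d) → ℝ≥0) (X : Finset (Pt d)) (Q : Set (Pt d)) (y : Pt d) : ℝ≥0 :=
  f (Metric.infDist y Q) X

/-- The smoothness parameter `ζ_{k,f}(X)`: the maximum, over nonempty `Q ⊆ X` with `|Q| ≤ k` and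
over `x ∈ X`, of `n f(d_center(x; Q); X) / ∑_{y ∈ X} f(d_center(y; Q); X)`, where `n = |X|`. All
the values are nonnegative, so that the supremum in `ℝ≥0` of this finite family is its maximum.
A set `Q` on which all weights vanish contributes `0`. -/
def zeta (f : ℝ → Finset (Pt d) → ℝ≥0) (X : Finset (Pt d)) (k : ℕ) : ℝ≥0 :=
  (X.powerset.filter fun Q => Q.Nonempty ∧ Q.card ≤ k).sup fun Q =>
    X.sup fun x => ((X.card : ℝ≥0) * weight f X Q x) * (∑ y ∈ X, weight f X Q y)⁻¹

/-- The distribution on a finite type that is proportional to `w`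
(the uniform distribution if `w` vanishes identically). -/
def proportionalTo {α : Type*} [Fintype α] [Nonempty α] (w : α → ℝ≥0) : PMF α :=
  if h : ∑ a, w a = 0 then PMF.uniformOfFintype α
  else PMF.ofFintype (fun a => ((w a / ∑ b, w b : ℝ≥0) : ℝ≥0∞)) (by
    rw [← ENNReal.ofNNReal_finsetSum, ← Finset.sum_div, div_self h, ENNReal.coe_one])

/-- The law of the centres `(c_1, …, c_k)` chosen by the generic seeding algorithm on `X`: `c_1` is
uniform, and `c_i` has probability proportional to `f(d_center(c_i; {c_1, …, c_{i-1}}); X)`. -/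
def genericSeeding (X : Finset (Pt d)) [Nonempty X] (f : ℝ → Finset (Pt d) → ℝ≥0) :
    (k : ℕ) → PMF (Fin k → X)
  | 0 => PMF.pure Fin.elim0
  | 1 => (PMF.uniformOfFintype X).map fun y _ => y
  | k + 2 => (genericSeeding X f (k + 1)).bind fun c =>
      (proportionalTo fun y : X => weight f X (Set.range fun j => (c j : Pt d)) y).map fun y =>
        Fin.snoc (α := fun _ => X) c y

/-- The probability that `w y / w x > z` for `z` uniform in `(0, 1)`, i.e. `min (1, w y / w x)`;
it is `1` when `w x = 0`. -/
def acceptProb {α : Type*} (w : α → ℝ≥0) (x y : α) : ℝ≥0 :=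
  if w x ≤ w y then 1 else w y / w x

theorem acceptProb_le_one {α : Type*} (w : α → ℝ≥0) (x y : α) : acceptProb w x y ≤ 1 := by
  unfold acceptProb
  split_ifs with h
  · exact le_rfl
  · exact div_le_one_of_le₀ (not_le.mp h).le zero_le

/-- The acceptance coin: `true` with probability `p` and `false` with probability `1 - p`. -/
def coin (p : ℝ≥0) (h : p ≤ 1) : PMF Bool :=
  PMF.ofFintype (fun b => ((if b then p else 1 - p : ℝ≥0) : ℝ≥0∞)) (by
    rw [← ENNReal.ofNNReal_finsetSum]
    simp [h])

/-- One step of the Markov chain: the current candidate `x` is replaced by the fresh sample `y` with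
probability `acceptProb w x y` and is kept otherwise. -/
def mcmcStep {α : Type*} (w : α → ℝ≥0) (x y : α) : PMF α :=
  (coin (acceptProb w x y) (acceptProb_le_one w x y)).map fun b => if b then y else x

/-- The inner loop on the samples `b 0, b 1, …, b (m - 1)`: the first one is the initial candidate,
the others are proposed one after the other. -/
def mcmcChain {α : Type*} {m : ℕ} [NeZero m] (w : α → ℝ≥0) (b : Fin m → α) : PMF α :=
  (List.ofFn b).tail.foldlM (mcmcStep w) (b 0)

/-- The law, over the acceptance coins, of the centres `(c_1, …, c_k)` that MCMC seeding chooses when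
it is run on given `m k` samples, arranged in `k` blocks of `m` samples. The first centre is a sample
of the first block, and the `i`-th centre, `i ≥ 2`, is the outcome of the chain that consumes the
`i`-th block and whose weights are those of the centres chosen so far. No sample is used twice. -/
def apxSeedingOn (X : Finset (Pt d)) (f : ℝ → Finset (Pt d) → ℝ≥0) (m : ℕ) [NeZero m] :
    (k : ℕ) → (Fin k → Fin m → X) → PMF (Fin k → X)
  | 0, _ => PMF.pure Fin.elim0
  | 1, x => PMF.pure fun _ => x 0 0
  | k + 2, x => (apxSeedingOn X f m (k + 1) (Fin.init x)).bind fun c =>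
      (mcmcChain (fun y : X => weight f X (Set.range fun j => (c j : Pt d)) y)
        (x (Fin.last (k + 1)))).map fun y => Fin.snoc (α := fun _ => X) c y

/-- The law of the centres chosen by MCMC seeding run on `m k` samples drawn independently and
uniformly, with replacement, from `X`. -/
def apxSeeding (X : Finset (Pt d)) [Nonempty X] (f : ℝ → Finset (Pt d) → ℝ≥0)
    (m : ℕ) [NeZero m] (k : ℕ) : PMF (Fin k → X) :=
  (PMF.uniformOfFintype (Fin k → Fin m → X)).bind (apxSeedingOn X f m k)

/-- A rule that assigns every point to a nearest centre, with arbitrary tie-breaking: for the centres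
`c`, the `j`-th cluster of the induced partition is `{x | part c x = j}`. -/
def IsNearestCenterRule {X : Finset (Pt d)} {k : ℕ} (part : (Fin k → X) → X → Fin k) : Prop :=
  ∀ (c : Fin k → X) (x : X) (j : Fin k),
    dist (x : Pt d) (c (part c x) : Pt d) ≤ dist (x : Pt d) (c j : Pt d)

/-- The cost of a `k`-clustering `S` of `X` with respect to a `k`-clustering `G` of `X`. A
`k`-clustering is given by its labelling: `x` lies in the `j`-th cluster of `S` iff `S x = j`. -/
def cost {X : Finset (Pt d)} {k : ℕ} (S G : X → Fin k) : ℝ :=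
  1 / (X.card : ℝ) * ⨅ σ : Equiv.Perm (Fin k),
    ∑ x : X, ∑ j : Fin k, if S x = σ j ∧ G x ≠ j then (1 : ℝ) else 0

/-- The expected cost of the partition induced by random centres with law `P`. -/
def expectedCost {X : Finset (Pt d)} {k : ℕ} (P : PMF (Fin k → X))
    (part : (Fin k → X) → X → Fin k) (G : X → Fin k) : ℝ :=
  ∑ c : Fin k → X, (P c).toReal * cost (part c) G

/-- A randomized estimator that makes `q` ground-truth queries: it draws at random (jointly) the
points to be queried and a rule that turns the `q` answers into an estimate. -/
abbrev QueryEstimator (X : Finset (Pt d)) (k q : ℕ) : Type :=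
  PMF ((Fin q → X) × ((Fin q → Fin k) → ℝ))

/-- The probability that the estimate is within `ε` of `t` when the oracle answers according to
the ground truth `G`. -/
def QueryEstimator.successProb {X : Finset (Pt d)} {k q : ℕ} (A : QueryEstimator X k q)
    (G : X → Fin k) (t ε : ℝ) : ℝ :=
  (A.toOuterMeasure {s | |s.2 (fun i => G (s.1 i)) - t| ≤ ε}).toReal

end Seeding

end

namespace Seeding

variable {d : ℕ}

/-! Claim (1) rests on one-sided domination of laws. Averaged over its samples, an inner loop is a
Metropolis chain with uniform proposals and stationary law π ∝ w. No point carries more than a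
fraction ζ/n of the weight, so a transition from any x reaches y with probability at least π(y)/ζ
(`inv_mul_toReal_proportionalTo_le`). By Doeblin's argument the outcome of the loop dominates (1 -
t)π pointwise, with t = (1 - 1/ζ)^m. Domination factors multiply along successive centres, so the
MCMC law dominates (1 - t)^(k-1) ≥ 1 - (k-1)t times the generic law, and t ≤ exp(-m/ζ) ≤ ε/k. As the
cost lies in [0, 1], the expectations differ by at most ε (`abs_sum_sub_sum_le`).

For claim (2), the estimate is the cost on s uniform points. Under a relabelling σ the cost is one
minus the mass of the cells (σ j, j) in the k × k table of label pairs. Cauchy–Schwarz bounds the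
squared error, for all σ at once, by k times the sum of the squared errors of all cell counts, whose
mean is at most s because the cell probabilities add up to one. So order k/ε² points give constant
confidence without a union bound over permutations (`card_sampleCost_far_le`), and a majority vote
over order log(1/δ) samples boosts it. For δ near 1 the budget may not pay for one such sample. Then
only success probability 1 - δ ≤ log(1/δ) is needed, and a coarser estimate with a random shift
achieves it (`exists_shifted_estimator`). -/

/-! ### Finite laws, domination and uniform products -/

theorem toReal_bind_apply {α β : Type*} [Fintype α] (p : PMF α) (g : α → PMF β) (b : β) :
    ((p.bind g) b).toReal = ∑ a, (p a).toReal * (g a b).toReal := by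
  rw [PMF.bind_apply, tsum_fintype, ENNReal.toReal_sum]
  · simp
  · exact fun a _ => ENNReal.mul_ne_top (p.apply_ne_top a) ((g a).apply_ne_top b)

theorem sum_toReal_eq_one {α : Type*} [Fintype α] (p : PMF α) : ∑ a, (p a).toReal = 1 := by
  rw [← ENNReal.toReal_sum fun a _ => p.apply_ne_top a, ← tsum_fintype (L := .unconditional α),
    p.tsum_coe,
    ENNReal.toReal_one]

theorem toReal_uniformOfFintype_apply {α : Type*} [Fintype α] [Nonempty α] (a : α) :
    (PMF.uniformOfFintype α a).toReal = (Fintype.card α : ℝ)⁻¹ := by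
  simp

/-- Expectations of `[0, 1]`-valued functions differ by at most `1 - s` when `s • q ≤ p`. -/
theorem abs_sum_sub_sum_le {α : Type*} [Fintype α] (p q : PMF α) {s : ℝ} (hs : s ≤ 1)
    (h : ∀ a, s * (q a).toReal ≤ (p a).toReal) (g : α → ℝ) (h0 : ∀ a, 0 ≤ g a)
    (h1 : ∀ a, g a ≤ 1) :
    |∑ a, (p a).toReal * g a - ∑ a, (q a).toReal * g a| ≤ 1 - s := by
  have hp := sum_toReal_eq_one p
  have hq := sum_toReal_eq_one q
  have e1 : 0 ≤ ∑ a, ((p a).toReal - s * (q a).toReal) * g a :=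
    Finset.sum_nonneg fun a _ => mul_nonneg (sub_nonneg.2 (h a)) (h0 a)
  have e2 : ∑ a, ((p a).toReal - s * (q a).toReal) * g a ≤
      ∑ a, ((p a).toReal - s * (q a).toReal) :=
    Finset.sum_le_sum fun a _ => mul_le_of_le_one_right (sub_nonneg.2 (h a)) (h1 a)
  have e3 : 0 ≤ ∑ a, (q a).toReal * g a :=
    Finset.sum_nonneg fun a _ => mul_nonneg ENNReal.toReal_nonneg (h0 a)
  have e4 : ∑ a, (q a).toReal * g a ≤ ∑ a, (q a).toReal :=
    Finset.sum_le_sum fun a _ => mul_le_of_le_one_right ENNReal.toReal_nonneg (h1 a)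
  simp only [sub_mul, Finset.sum_sub_distrib, mul_assoc, ← Finset.mul_sum] at e1 e2
  rw [hp, hq] at e2
  rw [hq] at e4
  rw [abs_le]
  constructor <;> nlinarith

theorem uniformOfFintype_eq_bind_map {α β γ : Type*} [Fintype α] [Nonempty α] [Fintype β]
    [Nonempty β] [Fintype γ] [Nonempty γ] (e : α × β ≃ γ) :
    PMF.uniformOfFintype γ =
      (PMF.uniformOfFintype α).bind fun a => (PMF.uniformOfFintype β).map fun b => e (a, b) := by
  classical
  ext c
  obtain ⟨⟨a, b⟩, rfl⟩ := e.surjective c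
  rw [PMF.bind_apply, tsum_fintype, Finset.sum_eq_single a]
  · rw [PMF.map_apply, tsum_fintype, Finset.sum_eq_single b]
    · simp only [PMF.uniformOfFintype_apply, if_true, ← Fintype.card_congr e, Fintype.card_prod,
        Nat.cast_mul]
      rw [ENNReal.mul_inv] <;> simp
    · intro b' _ hb
      simp [Ne.symm hb]
    · simp
  · intro a' _ ha
    rw [PMF.map_apply]
    simp [Ne.symm ha]
  · simp

theorem uniformOfFintype_map_of_equiv {α β γ : Type*} [Fintype α] [Nonempty α] [Fintype β]
    [Nonempty β] [Fintype γ] [Nonempty γ] (e : α × β ≃ γ) (g : γ → α)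
    (hg : ∀ a b, g (e (a, b)) = a) :
    (PMF.uniformOfFintype γ).map g = PMF.uniformOfFintype α := by
  rw [uniformOfFintype_eq_bind_map e, PMF.map_bind]
  simp only [PMF.map_comp]
  have : ∀ a, (g ∘ fun b => e (a, b)) = Function.const β a := fun a => by ext b; exact hg a b
  simp [this, PMF.map_const]

/-! ### The Metropolis chain and Doeblin minorization -/

/-- The Metropolis kernel: propose a uniform point and accept it as `mcmcStep` does. -/
noncomputable def metropolis {α : Type*} [Fintype α] [Nonempty α] (w : α → ℝ≥0) (x : α) : PMF α :=
  (PMF.uniformOfFintype α).bind (mcmcStep w x)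

/-- The law of the Metropolis chain after `m` steps. -/
noncomputable def metropolisIter {α : Type*} [Fintype α] [Nonempty α] (w : α → ℝ≥0) :
    ℕ → α → PMF α
  | 0, x => PMF.pure x
  | m + 1, x => (metropolis w x).bind (metropolisIter w m)

/-- Deferred decisions: each sample is used once, so drawing all of them beforehand has the same
effect as drawing each one when it is proposed. -/
theorem uniformOfFintype_bind_foldlM {α : Type*} [Fintype α] [Nonempty α] (w : α → ℝ≥0) (m : ℕ)
    (x : α) :
    ((PMF.uniformOfFintype (Fin m → α)).bind fun b => (List.ofFn b).foldlM (mcmcStep w) x) =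
      metropolisIter w m x := by
  induction m generalizing x with
  | zero =>
    simp only [List.ofFn_zero, List.foldlM_nil, metropolisIter]
    exact PMF.bind_const _ _
  | succ m ih =>
    rw [uniformOfFintype_eq_bind_map (Fin.consEquiv fun _ : Fin (m + 1) => α)]
    simp only [PMF.bind_bind, PMF.bind_map, metropolisIter, metropolis]
    congr 1
    ext1 y
    -- The coin for the first proposal is independent of the later samples, so the two draws may be
    -- swapped.
    rw [← funext ih, PMF.bind_comm (mcmcStep w x y)]
    congr 1
    ext1 b
    show (List.ofFn (Fin.cons y b : Fin (m + 1) → α)).foldlM (mcmcStep w) x = _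
    rw [List.ofFn_cons, List.foldlM_cons]
    rfl

theorem uniformOfFintype_bind_mcmcChain {α : Type*} [Fintype α] [Nonempty α] (w : α → ℝ≥0)
    (m : ℕ) :
    (PMF.uniformOfFintype (Fin (m + 1) → α)).bind (mcmcChain w) =
      (PMF.uniformOfFintype α).bind (metropolisIter w m) := by
  rw [uniformOfFintype_eq_bind_map (Fin.consEquiv fun _ : Fin (m + 1) => α)]
  simp only [PMF.bind_bind, PMF.bind_map]
  congr 1
  ext1 y
  rw [← uniformOfFintype_bind_foldlM]
  congr 1
  ext1 b
  simp [mcmcChain]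

theorem toReal_mcmcStep_apply {α : Type*} [DecidableEq α] (w : α → ℝ≥0) (x y z : α) :
    (mcmcStep w x y z).toReal = (if z = y then (acceptProb w x y : ℝ) else 0) +
      (if z = x then 1 - (acceptProb w x y : ℝ) else 0) := by
  have h := acceptProb_le_one w x y
  rw [mcmcStep, PMF.map_apply, tsum_fintype, ENNReal.toReal_sum]
  · simp only [Fintype.sum_bool, coin, PMF.ofFintype_apply, if_true, Bool.false_eq_true, if_false]
    have e : ((1 : ℝ≥0∞) - acceptProb w x y).toReal = 1 - (acceptProb w x y : ℝ) := by
      rw [← ENNReal.coe_one, ← ENNReal.coe_sub, ENNReal.coe_toReal, NNReal.coe_sub h,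
        NNReal.coe_one]
    congr 1 <;> split_ifs <;> simp [e]
  · intro b _
    split_ifs
    all_goals first
      | exact PMF.apply_ne_top _ _
      | exact ENNReal.zero_ne_top

theorem toReal_metropolis_apply {α : Type*} [Fintype α] [Nonempty α] [DecidableEq α]
    (w : α → ℝ≥0) (x z : α) :
    (metropolis w x z).toReal = (Fintype.card α : ℝ)⁻¹ * acceptProb w x z +
      if z = x then (Fintype.card α : ℝ)⁻¹ * ∑ y, (1 - (acceptProb w x y : ℝ)) else 0 := by
  rw [metropolis, toReal_bind_apply]
  simp only [toReal_uniformOfFintype_apply, toReal_mcmcStep_apply, ← Finset.mul_sum,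
    Finset.sum_add_distrib, mul_add]
  congr 1
  · simp
  · split_ifs <;> simp

theorem le_toReal_metropolis_apply {α : Type*} [Fintype α] [Nonempty α] (w : α → ℝ≥0) (x z : α) :
    (Fintype.card α : ℝ)⁻¹ * acceptProb w x z ≤ (metropolis w x z).toReal := by
  classical
  rw [toReal_metropolis_apply, le_add_iff_nonneg_right]
  split_ifs
  · refine mul_nonneg (by positivity) (Finset.sum_nonneg fun y _ => ?_)
    have := acceptProb_le_one w x y
    exact sub_nonneg.2 (by exact_mod_cast this)
  · exact le_rfl

theorem mul_acceptProb {α : Type*} (w : α → ℝ≥0) (x y : α) :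
    w x * acceptProb w x y = min (w x) (w y) := by
  unfold acceptProb
  split_ifs with h
  · simp [h]
  · have h' := not_le.1 h
    rw [min_eq_right h'.le, mul_div_cancel₀ _ (pos_of_gt h').ne']

theorem toReal_proportionalTo_apply {α : Type*} [Fintype α] [Nonempty α] (w : α → ℝ≥0)
    (h : ∑ a, w a ≠ 0) (a : α) :
    (proportionalTo w a).toReal = w a / ∑ b, (w b : ℝ) := by
  rw [proportionalTo, dif_neg h, PMF.ofFintype_apply]
  simp

/-- Detailed balance: before normalization both sides equal min (w x) (w y). When all weights
vanish, the target is uniform and every proposal is accepted. -/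
theorem toReal_proportionalTo_mul_acceptProb_comm {α : Type*} [Fintype α] [Nonempty α]
    (w : α → ℝ≥0) (x y : α) :
    (proportionalTo w x).toReal * acceptProb w x y =
      (proportionalTo w y).toReal * acceptProb w y x := by
  by_cases h : ∑ a, w a = 0
  · have hw : ∀ a, w a = 0 := by simpa using h
    simp [proportionalTo, acceptProb, hw]
  · have h1 : (w x : ℝ) * acceptProb w x y = w y * acceptProb w y x := by
      exact_mod_cast (mul_acceptProb w x y).trans
        ((min_comm _ _).trans (mul_acceptProb w y x).symm)
    rw [toReal_proportionalTo_apply w h, toReal_proportionalTo_apply w h, div_mul_eq_mul_div,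
      div_mul_eq_mul_div, h1]

theorem sum_toReal_proportionalTo_mul_metropolis {α : Type*} [Fintype α] [Nonempty α]
    (w : α → ℝ≥0) (z : α) :
    ∑ x, (proportionalTo w x).toReal * (metropolis w x z).toReal = (proportionalTo w z).toReal := by
  classical
  have hn : (Fintype.card α : ℝ) ≠ 0 := by simp
  simp only [toReal_metropolis_apply, mul_add, Finset.sum_add_distrib, mul_ite, mul_zero,
    Finset.sum_ite_eq, Finset.mem_univ, if_true, Finset.sum_sub_distrib, mul_sub,
    Finset.sum_const, Finset.card_univ, nsmul_eq_mul, mul_one, inv_mul_cancel₀ hn]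
  have : ∑ x, (proportionalTo w x).toReal * ((Fintype.card α : ℝ)⁻¹ * acceptProb w x z) =
      (proportionalTo w z).toReal * ((Fintype.card α : ℝ)⁻¹ * ∑ x, (acceptProb w z x : ℝ)) := by
    rw [Finset.mul_sum, Finset.mul_sum]
    refine Finset.sum_congr rfl fun x _ => ?_
    rw [mul_left_comm, toReal_proportionalTo_mul_acceptProb_comm, mul_left_comm]
  rw [this]
  ring

/-- Doeblin's contraction: if the Metropolis kernel dominates `g` times its stationary law, then
`m` steps shrink the defect `1 - s` of a start law by the factor `(1 - g) ^ m`. -/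
theorem le_toReal_bind_metropolisIter_apply {α : Type*} [Fintype α] [Nonempty α] (w : α → ℝ≥0)
    {g : ℝ} (hg : ∀ x y, g * (proportionalTo w y).toReal ≤ (metropolis w x y).toReal) (m : ℕ)
    (μ : PMF α) (s : ℝ) (hs : ∀ y, s * (proportionalTo w y).toReal ≤ (μ y).toReal) (y : α) :
    (1 - (1 - s) * (1 - g) ^ m) * (proportionalTo w y).toReal ≤
      ((μ.bind (metropolisIter w m)) y).toReal := by
  induction m generalizing μ s with
  | zero =>
    simpa [metropolisIter] using hs y
  | succ m ih =>
    have h : μ.bind (metropolisIter w (m + 1)) =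
        (μ.bind (metropolis w)).bind (metropolisIter w m) := by
      rw [PMF.bind_bind]; rfl
    rw [h]
    refine le_trans (le_of_eq ?_) (ih (μ.bind (metropolis w)) (1 - (1 - s) * (1 - g)) fun z => ?_)
    · ring
    · rw [toReal_bind_apply]
      -- The component s π is stationary. The rest μ - s π is nonnegative of mass 1 - s, so one step
      -- turns it into at least g (1 - s) π, and the defect becomes (1 - s)(1 - g).
      have e1 : ∑ x, ((μ x).toReal - s * (proportionalTo w x).toReal) *
          (g * (proportionalTo w z).toReal) ≤
          ∑ x, ((μ x).toReal - s * (proportionalTo w x).toReal) * (metropolis w x z).toReal :=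
        Finset.sum_le_sum fun x _ => mul_le_mul_of_nonneg_left (hg x z) (sub_nonneg.2 (hs x))
      rw [← Finset.sum_mul] at e1
      simp only [sub_mul, Finset.sum_sub_distrib, ← Finset.mul_sum, mul_assoc,
        sum_toReal_eq_one, sum_toReal_proportionalTo_mul_metropolis] at e1
      linarith

/-- If y is at least as heavy as x, the move is accepted and the weight bound at y suffices.
Otherwise acceptance is w y / w x, the factor w y cancels, and the weight bound at x is what is
needed. -/
theorem inv_mul_toReal_proportionalTo_le {α : Type*} [Fintype α] [Nonempty α] (w : α → ℝ≥0)
    {ζ : ℝ} (hζ : 1 ≤ ζ) (hw : ∀ x, Fintype.card α * (w x : ℝ) ≤ ζ * ∑ y, (w y : ℝ)) (x y : α) :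
    ζ⁻¹ * (proportionalTo w y).toReal ≤ (Fintype.card α : ℝ)⁻¹ * acceptProb w x y := by
  have hn : (0 : ℝ) < Fintype.card α := by exact_mod_cast Fintype.card_pos
  have hζ0 : 0 < ζ := by linarith
  by_cases h : ∑ a, w a = 0
  · have hw : ∀ a, w a = 0 := by simpa using h
    rw [proportionalTo, dif_pos h, toReal_uniformOfFintype_apply, acceptProb,
      if_pos (by simp [hw]), NNReal.coe_one, mul_one]
    exact mul_le_of_le_one_left (inv_nonneg.2 hn.le) (inv_le_one_of_one_le₀ hζ)
  · have hW : 0 < ∑ a, (w a : ℝ) := by exact_mod_cast pos_iff_ne_zero.2 h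
    rw [toReal_proportionalTo_apply w h, inv_mul_eq_div, inv_mul_eq_div, div_div,
      div_le_div_iff₀ (by positivity) hn]
    by_cases hxy : w x ≤ w y
    · rw [acceptProb, if_pos hxy, NNReal.coe_one]
      linarith [hw y]
    · have hx : (0 : ℝ) < w x := by exact_mod_cast pos_of_gt (not_le.1 hxy)
      rw [acceptProb, if_neg hxy, NNReal.coe_div, div_mul_eq_mul_div, le_div_iff₀ hx]
      have := mul_le_mul_of_nonneg_left (hw x) (w y).coe_nonneg
      linarith

/-- The law of the outcome of the chain dominates `1 - (1 - ζ⁻¹) ^ m` times its target. -/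
theorem le_toReal_bind_mcmcChain_apply {α : Type*} [Fintype α] [Nonempty α] (w : α → ℝ≥0)
    {ζ : ℝ} (hζ : 1 ≤ ζ) (hw : ∀ x, Fintype.card α * (w x : ℝ) ≤ ζ * ∑ y, (w y : ℝ)) (m : ℕ)
    [NeZero m] (y : α) :
    (1 - (1 - ζ⁻¹) ^ m) * (proportionalTo w y).toReal ≤
      (((PMF.uniformOfFintype (Fin m → α)).bind (mcmcChain w)) y).toReal := by
  obtain ⟨m, rfl⟩ := Nat.exists_eq_succ_of_ne_zero (NeZero.ne m)
  have h := uniformOfFintype_bind_mcmcChain w m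
  -- The uniform initial candidate already dominates ζ⁻¹ times the target. It thus counts as a step,
  -- and the exponent is the number of samples rather than of transitions.
  refine le_trans (le_of_eq ?_) ((le_toReal_bind_metropolisIter_apply w (g := ζ⁻¹)
    (fun x y => (inv_mul_toReal_proportionalTo_le w hζ hw x y).trans
      (le_toReal_metropolis_apply w x y)) m (PMF.uniformOfFintype α) ζ⁻¹ (fun y => ?_) y).trans
        (le_of_eq ?_))
  · rw [Nat.succ_eq_add_one, pow_succ']
  · rw [toReal_uniformOfFintype_apply]
    refine (inv_mul_toReal_proportionalTo_le w hζ hw y y).trans ?_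
    refine mul_le_of_le_one_right (by positivity) ?_
    exact_mod_cast acceptProb_le_one w y y
  · rw [← h]

/-! ### Comparison of MCMC seeding with generic seeding -/

theorem apxSeeding_one (X : Finset (Pt d)) [Nonempty X] (f : ℝ → Finset (Pt d) → ℝ≥0) (m : ℕ)
    [NeZero m] : apxSeeding X f m 1 = genericSeeding X f 1 := by
  obtain ⟨m, rfl⟩ := Nat.exists_eq_succ_of_ne_zero (NeZero.ne m)
  have h : (apxSeedingOn X f (m + 1) 1) =
      PMF.pure ∘ (fun y _ => y) ∘ (fun b : Fin (m + 1) → X => b 0) ∘ fun x : Fin 1 → Fin (m + 1) → X => x 0 := rfl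
  have h1 : (PMF.uniformOfFintype (Fin 1 → Fin (m + 1) → X)).map (fun x => x 0) =
      PMF.uniformOfFintype (Fin (m + 1) → X) :=
    uniformOfFintype_map_of_equiv (Fin.consEquiv fun _ : Fin 1 => Fin (m + 1) → X) _
      fun _ _ => rfl
  have h2 : (PMF.uniformOfFintype (Fin (m + 1) → X)).map (fun x => x 0) =
      PMF.uniformOfFintype X :=
    uniformOfFintype_map_of_equiv (Fin.consEquiv fun _ : Fin (m + 1) => X) _ fun _ _ => rfl
  show (PMF.uniformOfFintype (Fin 1 → Fin (m + 1) → X)).bind (apxSeedingOn X f (m + 1) 1) = _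
  rw [h, PMF.bind_pure_comp, ← PMF.map_comp, ← PMF.map_comp, h1, h2]
  rfl

/-- The last block of samples is independent of the earlier ones, hence of the centres chosen so
far, and can be averaged out on its own. -/
theorem apxSeeding_add_two (X : Finset (Pt d)) [Nonempty X] (f : ℝ → Finset (Pt d) → ℝ≥0) (m : ℕ)
    [NeZero m] (k : ℕ) :
    apxSeeding X f m (k + 2) = (apxSeeding X f m (k + 1)).bind fun c =>
      ((PMF.uniformOfFintype (Fin m → X)).bind (mcmcChain fun y : X =>
        weight f X (Set.range fun j => (c j : Pt d)) y)).map fun y =>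
          Fin.snoc (α := fun _ => X) c y := by
  let e : (Fin (k + 1) → Fin m → X) × (Fin m → X) ≃ (Fin (k + 2) → Fin m → X) :=
    (Equiv.prodComm _ _).trans (Fin.snocEquiv fun _ : Fin (k + 2) => Fin m → X)
  have he : ∀ a b, e (a, b) = Fin.snoc (α := fun _ => Fin m → X) a b := fun _ _ => rfl
  simp only [apxSeeding]
  rw [uniformOfFintype_eq_bind_map e]
  simp only [PMF.bind_bind, PMF.bind_map, PMF.map_bind]
  congr 1
  ext1 a
  rw [PMF.bind_comm (apxSeedingOn X f m (k + 1) a)]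
  congr 1
  ext1 b
  simp [apxSeedingOn, he]

theorem mul_toReal_bind_map_le {α β γ : Type*} [Fintype α] [Fintype β] (p q : PMF α)
    (r t : α → PMF β) (φ : α → β → γ) {s u : ℝ} (hs : 0 ≤ s)
    (h : ∀ a, u * (q a).toReal ≤ (p a).toReal)
    (h' : ∀ a b, s * (t a b).toReal ≤ (r a b).toReal) (c : γ) :
    u * s * ((q.bind fun a => (t a).map (φ a)) c).toReal ≤
      ((p.bind fun a => (r a).map (φ a)) c).toReal := by
  classical
  simp only [toReal_bind_apply, ← PMF.bind_pure_comp, Function.comp_apply, Finset.mul_sum]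
  refine Finset.sum_le_sum fun a _ => Finset.sum_le_sum fun b _ => ?_
  have := mul_le_mul (h a) (h' a b) (mul_nonneg hs ENNReal.toReal_nonneg) ENNReal.toReal_nonneg
  calc _ = u * (q a).toReal * (s * (t a b).toReal) * (PMF.pure (φ a b) c).toReal := by ring
    _ ≤ (p a).toReal * (r a b).toReal * (PMF.pure (φ a b) c).toReal :=
      mul_le_mul_of_nonneg_right this ENNReal.toReal_nonneg
    _ = _ := by ring

theorem card_mul_weight_le_zeta_mul (f : ℝ → Finset (Pt d) → ℝ≥0) (X : Finset (Pt d)) {i k : ℕ}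
    (hi : i + 1 ≤ k) (c : Fin (i + 1) → X) (x : X) :
    Fintype.card X * weight f X (Set.range fun j => (c j : Pt d)) x ≤
      zeta f X k * ∑ y : X, weight f X (Set.range fun j => (c j : Pt d)) y := by
  classical
  set w := weight f X (Set.range fun j => (c j : Pt d)) with hw
  have hsum : ∑ y : X, w y = ∑ y ∈ X, w y := Finset.sum_coe_sort X w
  by_cases h : ∑ y : X, w y = 0
  · have : w x = 0 := by
      rw [Finset.sum_eq_zero_iff] at h
      exact h x (Finset.mem_univ _)
    simp [this]
  · have hQ : ((Finset.univ.image fun j => (c j : Pt d) : Finset (Pt d)) : Set (Pt d)) =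
        Set.range fun j => (c j : Pt d) := by simp
    have hmem : (Finset.univ.image fun j => (c j : Pt d)) ∈
        X.powerset.filter fun Q => Q.Nonempty ∧ Q.card ≤ k := by
      simp only [Finset.mem_filter, Finset.mem_powerset]
      refine ⟨?_, Finset.univ_nonempty.image _, Finset.card_image_le.trans (by simpa using hi)⟩
      intro y hy
      obtain ⟨j, -, rfl⟩ := Finset.mem_image.1 hy
      exact (c j).2
    have h1 := Finset.le_sup (f := fun Q : Finset (Pt d) => X.sup fun x =>
      ((X.card : ℝ≥0) * weight f X Q x) * (∑ y ∈ X, weight f X Q y)⁻¹) hmem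
    have h2 := Finset.le_sup (f := fun x =>
      ((X.card : ℝ≥0) * w x) * (∑ y ∈ X, w y)⁻¹) x.2
    simp only [hQ] at h1
    have h3 := h2.trans h1
    rw [← hsum, ← div_eq_mul_inv, div_le_iff₀ (pos_iff_ne_zero.2 h)] at h3
    rw [Fintype.card_coe]
    exact h3

/-- Summing the bound of `card_mul_weight_le_zeta_mul` over x gives W ≤ ζ W for the total weight W,
which forces W = 0 if ζ < 1. -/
theorem weight_eq_zero_of_zeta_lt_one (f : ℝ → Finset (Pt d) → ℝ≥0) (X : Finset (Pt d)) {i k : ℕ}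
    (hi : i + 1 ≤ k) (h : zeta f X k < 1) (c : Fin (i + 1) → X) (x : X) :
    weight f X (Set.range fun j => (c j : Pt d)) x = 0 := by
  have hX : 0 < (Fintype.card X : ℝ≥0) := by exact_mod_cast Fintype.card_pos_iff.2 ⟨x⟩
  have h1 := Finset.sum_le_sum fun (x : X) (_ : x ∈ Finset.univ) =>
    card_mul_weight_le_zeta_mul f X hi c x
  rw [← Finset.mul_sum, Finset.sum_const, Finset.card_univ, nsmul_eq_mul] at h1
  have h2 := le_of_mul_le_mul_left h1 hX
  by_contra hne
  have hpos : 0 < ∑ y : X, weight f X (Set.range fun j => (c j : Pt d)) y :=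
    Finset.sum_pos' (fun _ _ => zero_le) ⟨x, Finset.mem_univ _, pos_iff_ne_zero.2 hne⟩
  exact absurd h2 (not_le.2 (mul_lt_of_lt_one_left hpos h))

/-- The law of MCMC seeding dominates `s ^ (k - 1)` times the law of generic seeding if each chain
dominates `s` times its target. -/
theorem pow_mul_genericSeeding_le_apxSeeding (X : Finset (Pt d)) [Nonempty X]
    (f : ℝ → Finset (Pt d) → ℝ≥0) (m : ℕ) [NeZero m] {ζ : ℝ} (hζ : 1 ≤ ζ) (k : ℕ)
    (hw : ∀ i < k, ∀ (c : Fin (i + 1) → X) (x : X),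
      Fintype.card X * (weight f X (Set.range fun j => (c j : Pt d)) x : ℝ) ≤
        ζ * ∑ y : X, (weight f X (Set.range fun j => (c j : Pt d)) y : ℝ))
    (c : Fin (k + 1) → X) :
    (1 - (1 - ζ⁻¹) ^ m) ^ k * (genericSeeding X f (k + 1) c).toReal ≤
      (apxSeeding X f m (k + 1) c).toReal := by
  have hs : 0 ≤ 1 - (1 - ζ⁻¹) ^ m := by
    have h1 : ζ⁻¹ ≤ 1 := inv_le_one_of_one_le₀ hζ
    have h2 : 0 < ζ⁻¹ := by positivity
    exact sub_nonneg.2 (pow_le_one₀ (by linarith) (by linarith))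
  induction k with
  | zero => simp [apxSeeding_one]
  | succ k ih =>
    rw [apxSeeding_add_two, genericSeeding, pow_succ]
    exact mul_toReal_bind_map_le _ _ _ _ _ hs
      (ih fun i hi => hw i (by omega)) (fun c y =>
        le_toReal_bind_mcmcChain_apply _ hζ (hw k (by omega) c) m y) c

/-! ### The cost and the proof of the first claim -/

theorem sum_ite_eq_perm {k : ℕ} (σ : Equiv.Perm (Fin k)) (a b : Fin k) :
    (∑ j : Fin k, if a = σ j ∧ b ≠ j then (1 : ℝ) else 0) =
      if a = σ b then 0 else 1 := by
  rw [Finset.sum_eq_single (σ.symm a)]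
  · by_cases h : a = σ b
    · simp [h]
    · have : b ≠ σ.symm a := fun h' => h (by simp [h'])
      simp [h, this]
  · intro j _ hj
    have : a ≠ σ j := fun h' => hj (by simp [h'])
    simp [this]
  · simp

theorem cost_eq_iInf {X : Finset (Pt d)} {k : ℕ} (S G : X → Fin k) :
    cost S G = 1 / (X.card : ℝ) * ⨅ σ : Equiv.Perm (Fin k),
      ∑ x : X, if S x = σ (G x) then (0 : ℝ) else 1 := by
  simp only [cost, sum_ite_eq_perm]

theorem cost_nonneg {X : Finset (Pt d)} {k : ℕ} (S G : X → Fin k) : 0 ≤ cost S G := by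
  rw [cost_eq_iInf]
  refine mul_nonneg (by positivity) (Real.iInf_nonneg fun σ => Finset.sum_nonneg fun x _ => ?_)
  split_ifs <;> norm_num

theorem cost_le_one {X : Finset (Pt d)} {k : ℕ} (S G : X → Fin k) : cost S G ≤ 1 := by
  rw [cost_eq_iInf]
  have h : (⨅ σ : Equiv.Perm (Fin k), ∑ x : X, if S x = σ (G x) then (0 : ℝ) else 1) ≤ X.card := by
    refine (ciInf_le (Set.finite_range _).bddBelow 1).trans ?_
    refine (Finset.sum_le_card_nsmul _ _ 1 fun x _ => ?_).trans (by simp)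
    split_ifs <;> norm_num
  rw [one_div, inv_mul_eq_div]
  exact div_le_one_of_le₀ h (by positivity)

theorem abs_expectedCost_sub_le (X : Finset (Pt d)) [Nonempty X]
    (f : ℝ → Finset (Pt d) → ℝ≥0) {k : ℕ} (hk : 0 < k) {ε : ℝ} (hε : 0 < ε) (m : ℕ) [NeZero m]
    (hm : (zeta f X k : ℝ) * Real.log (k / ε) ≤ m) (part : (Fin k → X) → X → Fin k)
    (G : X → Fin k) :
    |expectedCost (apxSeeding X f m k) part G - expectedCost (genericSeeding X f k) part G| ≤ ε := by
  obtain ⟨k, rfl⟩ := Nat.exists_eq_succ_of_ne_zero hk.ne'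
  obtain ⟨ζ, hζ, hw, ht⟩ : ∃ ζ : ℝ, 1 ≤ ζ ∧ (∀ i < k, ∀ (c : Fin (i + 1) → X) (x : X),
      Fintype.card X * (weight f X (Set.range fun j => (c j : Pt d)) x : ℝ) ≤
        ζ * ∑ y : X, (weight f X (Set.range fun j => (c j : Pt d)) y : ℝ)) ∧
      (1 - ζ⁻¹) ^ m * (k + 1) ≤ ε := by
    -- When ζ < 1 all weights vanish. The value 1 then serves as ζ and the error term is 0, since m
    -- ≠ 0.
    by_cases h : zeta f X (k + 1) < 1
    · refine ⟨1, le_rfl, fun i hi c x => ?_, ?_⟩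
      · simp [weight_eq_zero_of_zeta_lt_one f X (by omega : i + 1 ≤ k + 1) h]
      · simp [NeZero.ne m, hε.le]
    · have h1 : (1 : ℝ) ≤ zeta f X (k + 1) := by exact_mod_cast not_lt.1 h
      refine ⟨(zeta f X (k + 1) : ℝ), h1, fun i hi c x => ?_, ?_⟩
      · exact_mod_cast card_mul_weight_le_zeta_mul f X (by omega : i + 1 ≤ k + 1) c x
      · set ζ : ℝ := ((zeta f X (k + 1) : ℝ≥0) : ℝ)
        have hζ0 : 0 < ζ := by linarith
        have hk0 : (0 : ℝ) < k + 1 := by positivity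
        rw [← le_div_iff₀ hk0]
        calc (1 - ζ⁻¹) ^ m ≤ Real.exp (-ζ⁻¹) ^ m :=
              pow_le_pow_left₀ (sub_nonneg.2 (inv_le_one_of_one_le₀ h1))
                (Real.one_sub_le_exp_neg _) _
          _ = Real.exp (-(m / ζ)) := by rw [← Real.exp_nat_mul]; congr 1; ring
          _ ≤ Real.exp (-Real.log ((k + 1) / ε)) := by
            rw [Real.exp_le_exp, neg_le_neg_iff, le_div_iff₀ hζ0, mul_comm]
            simpa using hm
          _ = ε / (k + 1) := by
            rw [Real.exp_neg, Real.exp_log (by positivity), inv_div]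
  have hinv : ζ⁻¹ ≤ 1 := inv_le_one_of_one_le₀ hζ
  have hinv0 : 0 < ζ⁻¹ := by positivity
  have ht0 : 0 ≤ (1 - ζ⁻¹) ^ m := pow_nonneg (by linarith) m
  have ht1 : (1 - ζ⁻¹) ^ m ≤ 1 := pow_le_one₀ (by linarith) (by linarith)
  have hdom := pow_mul_genericSeeding_le_apxSeeding X f m hζ k hw
  -- Bernoulli's inequality. There are k + 1 centres but only k chains, as the first centre is
  -- exactly uniform.
  have hB : 1 - (k : ℝ) * (1 - ζ⁻¹) ^ m ≤ (1 - (1 - ζ⁻¹) ^ m) ^ k := by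
    have := one_add_mul_le_pow (a := -(1 - ζ⁻¹) ^ m) (by linarith) k
    simpa [sub_eq_add_neg] using this
  refine (abs_sum_sub_sum_le _ _ (pow_le_one₀ (by linarith) (by linarith)) hdom
    (fun c => cost (part c) G) (fun c => cost_nonneg _ _) fun c => cost_le_one _ _).trans ?_
  nlinarith

/-! ### Empirical cost of a uniform sample -/

/-- The success probability of an estimator driven by a uniform seed. -/
theorem successProb_map_uniformOfFintype {X : Finset (Pt d)} {k q : ℕ} {Ω : Type*} [Fintype Ω]
    [Nonempty Ω] (x : Ω → Fin q → X) (r : Ω → (Fin q → Fin k) → ℝ) (G : X → Fin k) (t ε : ℝ) :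
    QueryEstimator.successProb ((PMF.uniformOfFintype Ω).map fun ω => (x ω, r ω)) G t ε =
      (Finset.univ.filter fun ω => |r ω (fun i => G (x ω i)) - t| ≤ ε).card / Fintype.card Ω := by
  classical
  rw [QueryEstimator.successProb, PMF.toOuterMeasure_map_apply,
    PMF.toOuterMeasure_uniformOfFintype_apply, ENNReal.toReal_div, ENNReal.toReal_natCast,
    ENNReal.toReal_natCast, Fintype.card_subtype]
  rfl

/-- The variance of a sum of independent centred variables, with counts in place of probabilities:
splitting off one coordinate, the cross term vanishes by `hu`. -/
theorem sum_sq_sum_of_sum_eq_zero {α : Type*} [Fintype α] (u : α → ℝ) (hu : ∑ x, u x = 0)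
    (s : ℕ) :
    Fintype.card α * ∑ ω : Fin s → α, (∑ l, u (ω l)) ^ 2 =
      s * (Fintype.card α : ℝ) ^ s * ∑ x, u x ^ 2 := by
  induction s with
  | zero => simp
  | succ s ih =>
    rw [← (Fin.consEquiv fun _ : Fin (s + 1) => α).sum_comp, Fintype.sum_prod_type]
    simp only [Fin.consEquiv_apply, Fin.sum_univ_succ, Fin.cons_zero, Fin.cons_succ, add_sq,
      Finset.sum_add_distrib, ← Finset.mul_sum, ← Finset.sum_mul, hu, mul_zero, zero_mul, add_zero,
      Finset.sum_const, Finset.card_univ, nsmul_eq_mul, Fintype.card_fun, Fintype.card_fin]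
    rw [mul_add, ih]
    push_cast
    ring

/-- The second moment of the error of an empirical sum. -/
theorem sum_sq_sum_sub_le {α : Type*} [Fintype α] [Nonempty α] (h : α → ℝ) (s : ℕ) :
    Fintype.card α * ∑ ω : Fin s → α,
        (∑ l, h (ω l) - s * ((∑ x, h x) / Fintype.card α)) ^ 2 ≤
      s * (Fintype.card α : ℝ) ^ s * ∑ x, h x ^ 2 := by
  have hn : (Fintype.card α : ℝ) ≠ 0 := by simp
  set M := (∑ x, h x) / Fintype.card α with hM
  have hM' : ∑ x, h x = Fintype.card α * M := by rw [hM]; field_simp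
  have h0 : ∑ x, (h x - M) = 0 := by simp [hM']
  have h1 := sum_sq_sum_of_sum_eq_zero (fun x => h x - M) h0 s
  simp only [Finset.sum_sub_distrib, Finset.sum_const, Finset.card_univ, Fintype.card_fin,
    nsmul_eq_mul] at h1
  rw [h1]
  refine mul_le_mul_of_nonneg_left ?_ (by positivity)
  simp only [sub_sq, Finset.sum_sub_distrib, Finset.sum_add_distrib, ← Finset.mul_sum,
    ← Finset.sum_mul, hM', Finset.sum_const, Finset.card_univ, nsmul_eq_mul]
  nlinarith [mul_nonneg (Nat.cast_nonneg (α := ℝ) (Fintype.card α)) (sq_nonneg M)]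

theorem abs_iInf_sub_iInf_le {ι : Type*} [Finite ι] [Nonempty ι] (a b : ι → ℝ) {c : ℝ}
    (h : ∀ i, |a i - b i| ≤ c) : |(⨅ i, a i) - ⨅ i, b i| ≤ c := by
  have ha : BddBelow (Set.range a) := (Set.finite_range a).bddBelow
  have hb : BddBelow (Set.range b) := (Set.finite_range b).bddBelow
  rw [abs_le]
  constructor
  · have : (⨅ i, b i) - c ≤ ⨅ i, a i := le_ciInf fun i => by
      linarith [ciInf_le hb i, (abs_le.1 (h i)).1]
    linarith
  · have : (⨅ i, a i) - c ≤ ⨅ i, b i := le_ciInf fun i => by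
      linarith [ciInf_le ha i, (abs_le.1 (h i)).2]
    linarith

/-- The cost of a clustering on a sample, from the labels `a` of the sample in the clustering and its
labels `b` in the ground truth. -/
noncomputable def sampleCost {k s : ℕ} (a b : Fin s → Fin k) : ℝ :=
  1 / (s : ℝ) * ⨅ σ : Equiv.Perm (Fin k), ∑ l, if a l = σ (b l) then (0 : ℝ) else 1

/-- The error of the empirical count of the points with label `i` in `S` and label `j` in `G`. -/
noncomputable def countError {α : Type*} [Fintype α] {k s : ℕ} (S G : α → Fin k) (ω : Fin s → α)
    (i j : Fin k) : ℝ :=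
  ∑ l, (if S (ω l) = i ∧ G (ω l) = j then (1 : ℝ) else 0) -
    s * ((∑ x, if S x = i ∧ G x = j then (1 : ℝ) else 0) / Fintype.card α)

theorem sum_ite_perm_eq {α : Type*} [Fintype α] {k : ℕ} (a b : α → Fin k)
    (σ : Equiv.Perm (Fin k)) :
    (∑ x, if a x = σ (b x) then (0 : ℝ) else 1) =
      Fintype.card α - ∑ j, ∑ x, if a x = σ j ∧ b x = j then (1 : ℝ) else 0 := by
  rw [Finset.sum_comm, eq_sub_iff_add_eq, ← Finset.sum_add_distrib, ← Finset.card_univ,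
    ← nsmul_one, ← Finset.sum_const]
  refine Finset.sum_congr rfl fun x _ => ?_
  rw [Finset.sum_eq_single (b x)]
  · by_cases h : a x = σ (b x) <;> simp [h]
  · intro j _ hj
    simp [Ne.symm hj]
  · simp

theorem sq_sampleCost_sub_cost_le {X : Finset (Pt d)} [Nonempty X] {k s : ℕ} (hs : 0 < s)
    (S G : X → Fin k) (ω : Fin s → X) :
    (s * (sampleCost (fun l => S (ω l)) (fun l => G (ω l)) - cost S G)) ^ 2 ≤
      k * ∑ i, ∑ j, countError S G ω i j ^ 2 := by
  have hs' : (s : ℝ) ≠ 0 := by positivity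
  have hn : (Fintype.card X : ℝ) ≠ 0 := by exact_mod_cast Fintype.card_ne_zero
  set B := (k : ℝ) * ∑ i, ∑ j, countError S G ω i j ^ 2 with hB
  have hB0 : 0 ≤ B := mul_nonneg (by positivity)
    (Finset.sum_nonneg fun i _ => Finset.sum_nonneg fun j _ => sq_nonneg _)
  have key : |s * (sampleCost (fun l => S (ω l)) (fun l => G (ω l)) - cost S G)| ≤ √B := by
    have e1 : s * (sampleCost (fun l => S (ω l)) (fun l => G (ω l)) - cost S G) =
        (⨅ σ : Equiv.Perm (Fin k), ∑ l, if S (ω l) = σ (G (ω l)) then (0 : ℝ) else 1) -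
        ⨅ σ : Equiv.Perm (Fin k), s / (Fintype.card X : ℝ) *
          ∑ x : X, if S x = σ (G x) then (0 : ℝ) else 1 := by
      rw [cost_eq_iInf, sampleCost, ← Real.mul_iInf_of_nonneg (by positivity), Fintype.card_coe,
        mul_sub, ← mul_assoc, ← mul_assoc, mul_one_div_cancel hs', one_mul, mul_one_div]
    rw [e1]
    -- A bound that does not depend on σ passes to the minima.
    refine abs_iInf_sub_iInf_le _ _ fun σ => ?_
    refine Real.abs_le_sqrt ?_
    have e2 : (∑ l, if S (ω l) = σ (G (ω l)) then (0 : ℝ) else 1) -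
        s / (Fintype.card X : ℝ) * (∑ x : X, if S x = σ (G x) then (0 : ℝ) else 1) =
        -∑ j, countError S G ω (σ j) j := by
      rw [sum_ite_perm_eq (fun l => S (ω l)) (fun l => G (ω l)), sum_ite_perm_eq S G,
        Fintype.card_fin]
      simp only [countError, Finset.sum_sub_distrib, ← Finset.mul_sum, ← Finset.sum_div]
      field_simp
      ring
    rw [e2, neg_sq]
    -- Cauchy–Schwarz over the k cells (σ j, j). Enlarging the sum to all cells then removes σ.
    refine sq_sum_le_card_mul_sum_sq.trans ?_
    rw [Finset.card_univ, Fintype.card_fin, hB]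
    refine mul_le_mul_of_nonneg_left ?_ (by positivity)
    rw [Finset.sum_comm]
    exact Finset.sum_le_sum fun j _ => Finset.single_le_sum (f := fun i => countError S G ω i j ^ 2)
      (fun i _ => sq_nonneg _) (Finset.mem_univ (σ j))
  have := pow_le_pow_left₀ (abs_nonneg _) key 2
  rwa [sq_abs, Real.sq_sqrt hB0] at this

/-- Each cell contributes at most s times its probability, and every point lies in exactly one cell,
so the k² cells together cost no factor of k. -/
theorem sum_sq_countError_le {α : Type*} [Fintype α] [Nonempty α] {k : ℕ} (s : ℕ)
    (S G : α → Fin k) :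
    ∑ ω : Fin s → α, ∑ i, ∑ j, countError S G ω i j ^ 2 ≤ s * (Fintype.card α : ℝ) ^ s := by
  have hn : (0 : ℝ) < Fintype.card α := by exact_mod_cast Fintype.card_pos
  have h : ∀ i j, Fintype.card α * ∑ ω : Fin s → α, countError S G ω i j ^ 2 ≤
      s * (Fintype.card α : ℝ) ^ s * ∑ x, if S x = i ∧ G x = j then (1 : ℝ) else 0 := fun i j => by
    simpa only [countError, ite_pow, one_pow, ne_eq, OfNat.ofNat_ne_zero, not_false_eq_true,
      zero_pow] using sum_sq_sum_sub_le (fun x => if S x = i ∧ G x = j then (1 : ℝ) else 0) s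
  have h2 := Finset.sum_le_sum fun i (_ : i ∈ Finset.univ) =>
    Finset.sum_le_sum fun j (_ : j ∈ Finset.univ) => h i j
  have h3 : ∑ i, ∑ j, ∑ x, (if S x = i ∧ G x = j then (1 : ℝ) else 0) = Fintype.card α := by
    have : ∀ x, ∑ i, ∑ j, (if S x = i ∧ G x = j then (1 : ℝ) else 0) = 1 := fun x => by
      simp [ite_and]
    calc _ = ∑ x, ∑ i, ∑ j, (if S x = i ∧ G x = j then (1 : ℝ) else 0) := by
          rw [Finset.sum_comm (s := Finset.univ (α := α))]
          exact Finset.sum_congr rfl fun i _ => Finset.sum_comm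
      _ = _ := by simp only [this, Finset.sum_const, Finset.card_univ, nsmul_one]
  simp only [← Finset.mul_sum, h3] at h2
  rw [mul_comm] at h2
  have h4 := le_of_mul_le_mul_right h2 hn
  refine le_trans (le_of_eq ?_) h4
  rw [Finset.sum_comm]
  refine Finset.sum_congr rfl fun i _ => ?_
  rw [Finset.sum_comm]

/-- Few samples of size `s` have a cost that is off by more than `η`. -/
theorem card_sampleCost_far_le {X : Finset (Pt d)} [Nonempty X] {k s : ℕ} (hs : 0 < s)
    (S G : X → Fin k) {η : ℝ} (hη : 0 < η) :
    (Finset.univ.filter fun ω : Fin s → X =>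
        ¬ |sampleCost (fun l => S (ω l)) (fun l => G (ω l)) - cost S G| ≤ η).card * (s * η ^ 2) ≤
      k * (Fintype.card (Fin s → X) : ℝ) := by
  have hs' : (0 : ℝ) < s := by positivity
  set F := Finset.univ.filter fun ω : Fin s → X =>
    ¬ |sampleCost (fun l => S (ω l)) (fun l => G (ω l)) - cost S G| ≤ η with hF
  -- Chebyshev's inequality in counting form.
  have h1 : (F.card : ℝ) * (s * η) ^ 2 ≤ ∑ ω : Fin s → X, k * ∑ i, ∑ j, countError S G ω i j ^ 2 := by
    rw [← nsmul_eq_mul, ← Finset.sum_const]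
    refine le_trans (Finset.sum_le_sum fun ω hω => ?_)
      (Finset.sum_le_sum_of_subset_of_nonneg (Finset.subset_univ F) fun ω _ _ => ?_)
    · refine le_trans ?_ (sq_sampleCost_sub_cost_le hs S G ω)
      have hω' := not_le.1 (Finset.mem_filter.1 hω).2
      rw [mul_pow, mul_pow]
      refine mul_le_mul_of_nonneg_left ?_ (sq_nonneg _)
      rw [← sq_abs (_ - _)]
      exact pow_le_pow_left₀ hη.le hω'.le 2
    · exact mul_nonneg (by positivity)
        (Finset.sum_nonneg fun i _ => Finset.sum_nonneg fun j _ => sq_nonneg _)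
  rw [← Finset.mul_sum] at h1
  have h2 := h1.trans (mul_le_mul_of_nonneg_left (sum_sq_countError_le s S G) (Nat.cast_nonneg k))
  rw [Fintype.card_fun, Fintype.card_fin, Nat.cast_pow]
  refine le_of_mul_le_mul_left ?_ hs'
  calc _ = (F.card : ℝ) * (s * η) ^ 2 := by ring
    _ ≤ _ := h2
    _ = _ := by ring

/-! ### Amplification by majority vote -/

/-- A value that is `η`-close to more than half of the values `v`, if there is one. -/
noncomputable def majorityValue {r : ℕ} (η : ℝ) (v : Fin r → ℝ) : ℝ :=
  open Classical in
  if h : ∃ c, r < 2 * (Finset.univ.filter fun i => |v i - c| ≤ η).card then h.choose else 0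

theorem abs_majorityValue_sub_le {r : ℕ} {η t : ℝ} {v : Fin r → ℝ}
    (h : r < 2 * (Finset.univ.filter fun i => |v i - t| ≤ η).card) :
    |majorityValue η v - t| ≤ 2 * η := by
  have hex : ∃ c, r < 2 * (Finset.univ.filter fun i => |v i - c| ≤ η).card := ⟨t, h⟩
  rw [majorityValue, dif_pos hex]
  have h' := hex.choose_spec
  set c := hex.choose
  -- Two strict majorities share an index i, and v i is within η of both c and t.
  obtain ⟨i, hi⟩ : ((Finset.univ.filter fun i => |v i - c| ≤ η) ∩
      (Finset.univ.filter fun i => |v i - t| ≤ η)).Nonempty := by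
    refine Finset.inter_nonempty_of_card_lt_card_add_card (s := Finset.univ)
      (Finset.subset_univ _) (Finset.subset_univ _) ?_
    rw [Finset.card_univ, Fintype.card_fin]
    omega
  simp only [Finset.mem_inter, Finset.mem_filter, Finset.mem_univ, true_and] at hi
  rw [abs_le] at hi ⊢
  constructor <;> linarith [hi.1.1, hi.1.2, (abs_le.1 hi.2).1, (abs_le.1 hi.2).2]

/-- If at most a `1 / 16` fraction of `β` is bad, at most a `2 ^ (-r)` fraction of the `r`-tuples has
at least `r / 2` bad entries. -/
theorem card_many_bad_mul_two_pow_le {β : Type*} [Fintype β] (p : β → Prop) [DecidablePred p]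
    (h : 16 * (Finset.univ.filter p).card ≤ Fintype.card β) (r : ℕ) :
    (Finset.univ.filter fun ω : Fin r → β =>
        r ≤ 2 * (Finset.univ.filter fun i => p (ω i)).card).card * 2 ^ r ≤
      Fintype.card (Fin r → β) := by
  -- An exponential-moment bound: weigh each tuple by 16 per bad entry. The total factorizes and is
  -- at most (2 |β|)^r, while a tuple with at least r / 2 bad entries weighs at least 4^r.
  have h1 : ∑ ω : Fin r → β, 16 ^ (Finset.univ.filter fun i => p (ω i)).card =
      (∑ b : β, if p b then 16 else 1) ^ r := by
    rw [← Fin.prod_const, Finset.prod_univ_sum, Fintype.piFinset_univ]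
    refine Finset.sum_congr rfl fun ω _ => ?_
    rw [Finset.prod_ite]
    simp
  have h2 : (∑ b : β, if p b then 16 else 1) ≤ 2 * Fintype.card β := by
    have : ∀ b : β, (if p b then 16 else 1) = (if p b then 15 else 0) + 1 := fun b => by
      split_ifs <;> rfl
    simp only [this, Finset.sum_add_distrib, ← Finset.sum_filter, Finset.sum_const, smul_eq_mul,
      Finset.card_univ]
    linarith
  set F := Finset.univ.filter fun ω : Fin r → β =>
    r ≤ 2 * (Finset.univ.filter fun i => p (ω i)).card
  have h3 : F.card * 4 ^ r ≤ ∑ ω : Fin r → β, 16 ^ (Finset.univ.filter fun i => p (ω i)).card := by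
    rw [← smul_eq_mul, ← Finset.sum_const]
    refine le_trans (Finset.sum_le_sum fun ω hω => ?_)
      (Finset.sum_le_sum_of_subset (Finset.subset_univ F))
    have : 16 = 4 ^ 2 := rfl
    rw [this, ← pow_mul]
    exact Nat.pow_le_pow_right (by norm_num) (Finset.mem_filter.1 hω).2
  have h4 := h3.trans (h1.le.trans (Nat.pow_le_pow_left h2 r))
  rw [Fintype.card_fun, Fintype.card_fin]
  refine Nat.le_of_mul_le_mul_right ?_ (show 0 < 2 ^ r by positivity)
  calc _ = F.card * 4 ^ r := by rw [mul_assoc, ← mul_pow]; norm_num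
    _ ≤ _ := h4
    _ = _ := by rw [mul_pow, mul_comm]

theorem div_card_filter_ge {Ω : Type*} [Fintype Ω] [Nonempty Ω] (p : Ω → Prop) [DecidablePred p]
    {δ : ℝ} (h : ((Finset.univ.filter fun ω => ¬ p ω).card : ℝ) ≤ δ * Fintype.card Ω) :
    1 - δ ≤ (Finset.univ.filter p).card / (Fintype.card Ω : ℝ) := by
  have hn : (0 : ℝ) < Fintype.card Ω := by exact_mod_cast Fintype.card_pos
  have := Finset.card_filter_add_card_filter_not (s := (Finset.univ : Finset Ω)) p
  rw [Finset.card_univ] at this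
  have h' : ((Finset.univ.filter p).card : ℝ) + (Finset.univ.filter fun ω => ¬ p ω).card =
    Fintype.card Ω := by exact_mod_cast this
  rw [le_div_iff₀ hn]
  linarith

/-- The estimator that takes a majority vote over `r` samples of size `s`. -/
theorem exists_majority_estimator {X : Finset (Pt d)} [Nonempty X] {k : ℕ} (S : X → Fin k)
    {ε : ℝ} (hε : 0 < ε) (s r : ℕ) (hs : 0 < s) (hsk : 64 * k ≤ s * ε ^ 2) :
    ∃ A : QueryEstimator X k (r * s), ∀ G : X → Fin k,
      1 - (1 / 2) ^ r ≤ A.successProb G (cost S G) ε := by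
  classical
  refine ⟨(PMF.uniformOfFintype (Fin r → Fin s → X)).map fun ω =>
    (fun i => ω (finProdFinEquiv.symm i).1 (finProdFinEquiv.symm i).2,
      fun a => majorityValue (ε / 2) fun i =>
        sampleCost (fun l => S (ω i l)) fun l => a (finProdFinEquiv (i, l))), fun G => ?_⟩
  rw [successProb_map_uniformOfFintype]
  simp only [Equiv.symm_apply_apply]
  refine div_card_filter_ge _ ?_
  let p : (Fin s → X) → Prop := fun ω =>
    ¬ |sampleCost (fun l => S (ω l)) (fun l => G (ω l)) - cost S G| ≤ ε / 2
  have h1 : 16 * (Finset.univ.filter p).card ≤ Fintype.card (Fin s → X) := by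
    have h := card_sampleCost_far_le hs S G (half_pos hε)
    rcases Nat.eq_zero_or_pos k with rfl | hk
    · exact (Fin.elim0 (S (Classical.arbitrary X)))
    have hk' : (0 : ℝ) < k := by positivity
    have h' : (k : ℝ) * (16 * ((Finset.univ.filter p).card : ℝ)) ≤
        k * (Fintype.card (Fin s → X) : ℝ) := by
      refine le_trans ?_ h
      have := mul_le_mul_of_nonneg_left hsk (Nat.cast_nonneg (α := ℝ) (Finset.univ.filter p).card)
      simp only [p] at this ⊢
      linarith
    exact_mod_cast le_of_mul_le_mul_left h' hk'
  have h2 := card_many_bad_mul_two_pow_le p h1 r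
  have h3 : (Finset.univ.filter fun ω : Fin r → Fin s → X => ¬ |majorityValue (ε / 2) (fun i =>
        sampleCost (fun l => S (ω i l)) fun l => G (ω i l)) - cost S G| ≤ ε).card ≤
      (Finset.univ.filter fun ω : Fin r → Fin s → X =>
        r ≤ 2 * (Finset.univ.filter fun i => p (ω i)).card).card := by
    refine Finset.card_le_card fun ω hω => ?_
    simp only [Finset.mem_filter, Finset.mem_univ, true_and] at hω ⊢
    by_contra hlt
    refine hω ?_
    have hc := Finset.card_filter_add_card_filter_not (s := (Finset.univ : Finset (Fin r)))
      fun i => p (ω i)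
    simp only [p, not_not, Finset.card_univ, Fintype.card_fin] at hc hlt
    have := abs_majorityValue_sub_le (r := r) (η := ε / 2) (t := cost S G)
      (v := fun i => sampleCost (fun l => S (ω i l)) fun l => G (ω i l)) (by omega)
    linarith
  have h4 := (Nat.mul_le_mul_right (2 ^ r) h3).trans h2
  rw [one_div, inv_pow, inv_mul_eq_div, le_div_iff₀ (by positivity)]
  exact_mod_cast h4

/-! ### Random shifts of a coarse estimate -/

/-- N intervals of half-length ε, centred at the negatives of the shifts, cover [-N ε, N ε]. -/
theorem exists_abs_add_grid_le {N : ℕ} (hN : 0 < N) {y ε : ℝ} (h : |y| ≤ N * ε) :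
    ∃ j < N, |y + (2 * (j : ℝ) + 1 - N) * ε| ≤ ε := by
  induction N, hN using Nat.le_induction generalizing y with
  | base => exact ⟨0, one_pos, by simpa using h⟩
  | succ N hN ih =>
    push_cast at h ⊢
    rw [abs_le] at h
    by_cases hy : -((N - 1) * ε) ≤ y
    · obtain ⟨j, hj, h'⟩ := ih (y := y - ε) (by rw [abs_le]; constructor <;> linarith)
      refine ⟨j, by omega, ?_⟩
      convert h' using 2
      ring
    · refine ⟨N, by omega, ?_⟩
      rw [abs_le]
      constructor <;> linarith

/-- Shifting an estimate that is `N ε`-accurate by a random element of an `ε`-net. -/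
theorem exists_shifted_estimator {X : Finset (Pt d)} [Nonempty X] {k s N : ℕ} (hN : 0 < N)
    {ε : ℝ} (v : (Fin s → X) → (Fin s → Fin k) → ℝ) (T : (X → Fin k) → ℝ)
    (hv : ∀ G, Fintype.card (Fin s → X) ≤ 2 * (Finset.univ.filter fun ω : Fin s → X =>
      |v ω (fun i => G (ω i)) - T G| ≤ N * ε).card) :
    ∃ A : QueryEstimator X k s, ∀ G : X → Fin k, 1 / (2 * N : ℝ) ≤ A.successProb G (T G) ε := by
  classical
  have : NeZero N := ⟨hN.ne'⟩
  refine ⟨(PMF.uniformOfFintype ((Fin s → X) × Fin N)).map fun ω =>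
    (ω.1, fun a => v ω.1 a + (2 * (ω.2 : ℝ) + 1 - N) * ε), fun G => ?_⟩
  rw [successProb_map_uniformOfFintype]
  -- Every good sample has at least one good shift among N, which costs a factor N in the success
  -- probability.
  have h1 : (Finset.univ.filter fun ω : Fin s → X =>
      |v ω (fun i => G (ω i)) - T G| ≤ N * ε).card ≤
      (Finset.univ.filter fun ω : (Fin s → X) × Fin N =>
        |v ω.1 (fun i => G (ω.1 i)) + (2 * (ω.2 : ℝ) + 1 - N) * ε - T G| ≤ ε).card := by
    refine le_trans (Finset.card_le_card fun ω hω => ?_) (Finset.card_image_le (f := Prod.fst))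
    have h := (Finset.mem_filter.1 hω).2
    simp only [Finset.mem_image, Finset.mem_filter, Finset.mem_univ, true_and, Prod.exists,
      exists_and_right, exists_eq_right]
    obtain ⟨j, hj, h'⟩ := exists_abs_add_grid_le hN h
    exact ⟨⟨j, hj⟩, by
      convert h' using 2
      simp only
      ring⟩
  have h2 := (hv G).trans (Nat.mul_le_mul_left 2 h1)
  have h3 : (Fintype.card (Fin s → X) : ℝ) ≤ 2 * ((Finset.univ.filter fun ω : (Fin s → X) × Fin N =>
        |v ω.1 (fun i => G (ω.1 i)) + (2 * (ω.2 : ℝ) + 1 - N) * ε - T G| ≤ ε).card : ℝ) := by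
    exact_mod_cast h2
  have hc : (0 : ℝ) < Fintype.card (Fin s → X) := by exact_mod_cast Fintype.card_pos
  have hN' : (0 : ℝ) < N := by exact_mod_cast hN
  rw [Fintype.card_prod, Fintype.card_fin, Nat.cast_mul, div_le_div_iff₀ (by positivity)
    (by positivity)]
  nlinarith

/-! ### Choice of parameters within the query budget -/

theorem abs_half_sub_cost_le {X : Finset (Pt d)} {k : ℕ} (S G : X → Fin k) :
    |1 / 2 - cost S G| ≤ 1 / 2 := by
  have h0 := cost_nonneg S G
  have h1 := cost_le_one S G
  rw [abs_le]
  constructor <;> linarith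

theorem exists_constant_estimator {X : Finset (Pt d)} {k : ℕ} (S : X → Fin k) {ε : ℝ}
    (hε : 1 / 2 ≤ ε) :
    ∃ A : QueryEstimator X k 0, ∀ G : X → Fin k, 1 ≤ A.successProb G (cost S G) ε := by
  refine ⟨(PMF.uniformOfFintype Unit).map fun _ => (Fin.elim0, fun _ => 1 / 2), fun G => ?_⟩
  rw [successProb_map_uniformOfFintype, Finset.filter_true_of_mem]
  · simp
  · exact fun _ _ => (abs_half_sub_cost_le S G).trans hε

theorem exists_estimator_of_le_log {X : Finset (Pt d)} [Nonempty X] {k : ℕ} (hk : 0 < k) {ε δ : ℝ}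
    (hε : 0 < ε) (hε' : ε ≤ 1) (hδ : 0 < δ) (hL : 1 / 16 ≤ Real.log δ⁻¹) (S : X → Fin k) :
    ∃ q : ℕ, (q : ℝ) ≤ 1200 * k * (ε ^ 2)⁻¹ * Real.log δ⁻¹ ∧
      ∃ A : QueryEstimator X k q, ∀ G : X → Fin k, 1 - δ ≤ A.successProb G (cost S G) ε := by
  set L := Real.log δ⁻¹ with hLdef
  have hk1 : (1 : ℝ) ≤ k := by exact_mod_cast hk
  have hε2 : 0 < ε ^ 2 := by positivity
  have hinv : 1 ≤ (ε ^ 2)⁻¹ := (one_le_inv₀ hε2).2 (pow_le_one₀ hε.le hε')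
  have hkε : 1 ≤ k * (ε ^ 2)⁻¹ := one_le_mul_of_one_le_of_one_le hk1 hinv
  have hs1 := Nat.le_ceil (64 * (k * (ε ^ 2)⁻¹))
  have hs2 := (Nat.ceil_lt_add_one (a := 64 * (k * (ε ^ 2)⁻¹)) (by positivity)).le
  have hr1 := Nat.le_ceil (2 * L)
  have hr2 := (Nat.ceil_lt_add_one (a := 2 * L) (by positivity)).le
  set s := ⌈64 * (k * (ε ^ 2)⁻¹)⌉₊
  set r := ⌈2 * L⌉₊
  have hs0 : 0 < s := by
    have : (0 : ℝ) < s := by linarith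
    exact_mod_cast this
  obtain ⟨A, hA⟩ := exists_majority_estimator S hε s r hs0 (by
    have := mul_le_mul_of_nonneg_right hs1 hε2.le
    rwa [mul_assoc, mul_assoc, inv_mul_cancel₀ hε2.ne', mul_one] at this)
  refine ⟨r * s, ?_, A, fun G => le_trans ?_ (hA G)⟩
  · push_cast
    -- Rounding up costs 1 ≤ 16 L in r and 1 ≤ k / ε² in s.
    calc (r : ℝ) * s ≤ (18 * L) * (65 * (k * (ε ^ 2)⁻¹)) :=
          mul_le_mul (by linarith) (by linarith) (by positivity) (by positivity)
      _ = 1170 * (k * (ε ^ 2)⁻¹ * L) := by ring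
      _ ≤ 1200 * (k * (ε ^ 2)⁻¹ * L) :=
          mul_le_mul_of_nonneg_right (by norm_num) (by positivity)
      _ = _ := by ring
  · have h : (1 / 2 : ℝ) ^ r ≤ δ := by
      rw [one_div, inv_pow, inv_le_comm₀ (by positivity) hδ, ← Real.log_le_log_iff (by positivity)
        (by positivity), Real.log_pow]
      have := mul_le_mul hr1 Real.log_two_gt_d9.le (by norm_num) (by positivity)
      linarith
    linarith

/-- With L = log(1/δ), the budget allows accuracy of order ε / √L with probability 1/2. A random
shift among N ≈ 1 / √L grid points refines this to ε with probability 1 / (2N), of order √L, which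
for small L exceeds L ≥ 1 - δ. -/
theorem exists_estimator_of_log_le {X : Finset (Pt d)} [Nonempty X] {k : ℕ} (hk : 0 < k) {ε δ : ℝ}
    (hε : 0 < ε) (hδ : 0 < δ) (hδ' : δ < 1) (hL : Real.log δ⁻¹ ≤ 1 / 16)
    (S : X → Fin k) :
    ∃ q : ℕ, (q : ℝ) ≤ 1200 * k * (ε ^ 2)⁻¹ * Real.log δ⁻¹ ∧
      ∃ A : QueryEstimator X k q, ∀ G : X → Fin k, 1 - δ ≤ A.successProb G (cost S G) ε := by
  classical
  have hL0 : 0 < Real.log δ⁻¹ := Real.log_pos ((one_lt_inv₀ hδ).2 hδ')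
  have hδL : 1 - δ ≤ Real.log δ⁻¹ := by
    have := Real.log_le_sub_one_of_pos hδ
    rw [Real.log_inv]
    linarith
  set L := Real.log δ⁻¹
  have hk1 : (1 : ℝ) ≤ k := by exact_mod_cast hk
  have hε2 : 0 < ε ^ 2 := by positivity
  obtain ⟨a, ha, haL⟩ : ∃ a : ℝ, 0 < a ∧ a ^ 2 = L := ⟨√L, Real.sqrt_pos.2 hL0, Real.sq_sqrt hL0.le⟩
  have ha4 : a ≤ 1 / 4 := by nlinarith
  have hN1 : 1 ≤ ⌈a⁻¹⌉₊ * a := by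
    have := mul_le_mul_of_nonneg_right (Nat.le_ceil a⁻¹) ha.le
    rwa [inv_mul_cancel₀ ha.ne'] at this
  have hN2 : ⌈a⁻¹⌉₊ * a ≤ 2 := by
    have := mul_le_mul_of_nonneg_right
      (Nat.ceil_lt_add_one (a := a⁻¹) (by positivity)).le ha.le
    rw [add_mul, inv_mul_cancel₀ ha.ne'] at this
    linarith
  have hN : 0 < ⌈a⁻¹⌉₊ := Nat.ceil_pos.2 (by positivity)
  set N := ⌈a⁻¹⌉₊
  have hN' : (0 : ℝ) < N := by exact_mod_cast hN
  have hQ0 : 0 ≤ 1200 * k * (ε ^ 2)⁻¹ * L := by positivity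
  have hq1 := Nat.floor_le hQ0
  have hq2 := Nat.lt_floor_add_one (1200 * k * (ε ^ 2)⁻¹ * L)
  set Q := 1200 * k * (ε ^ 2)⁻¹ * L with hQ
  have hQε : Q * ε ^ 2 = 1200 * k * L := by
    rw [hQ]
    field_simp
  set s := ⌊Q⌋₊
  refine ⟨s, hq1, ?_⟩
  -- 2 N (1 - δ) ≤ 2 N a² ≤ 4 a ≤ 1.
  have hprob : 1 - δ ≤ 1 / (2 * N : ℝ) := by
    rw [le_div_iff₀ (by positivity)]
    nlinarith [mul_le_mul_of_nonneg_right hδL hN'.le, mul_le_mul_of_nonneg_left hN2 ha.le]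
  suffices ∃ A : QueryEstimator X k s, ∀ G : X → Fin k,
      1 / (2 * N : ℝ) ≤ A.successProb G (cost S G) ε by
    obtain ⟨A, hA⟩ := this
    exact ⟨A, fun G => hprob.trans (hA G)⟩
  rcases Nat.eq_zero_or_pos s with hs | hs
  -- With no query affordable, L is so small that a ≤ ε. Then N ε ≥ N a ≥ 1, and the blind guess 1/2
  -- is accurate enough to be shifted.
  · refine exists_shifted_estimator hN (fun _ _ => 1 / 2) (cost S) fun G => ?_
    rw [Finset.filter_true_of_mem, Finset.card_univ]
    · omega
    · refine fun _ _ => (abs_half_sub_cost_le S G).trans ?_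
      rw [hs, Nat.cast_zero, zero_add] at hq2
      have h1 : 1200 * k * L < ε ^ 2 := by
        rw [← hQε]
        exact mul_lt_of_lt_one_left hε2 hq2
      have h2 : a ≤ ε := by
        refine le_of_sq_le_sq ?_ hε.le
        rw [haL]
        nlinarith
      nlinarith [mul_le_mul_of_nonneg_left h2 hN'.le]
  · refine exists_shifted_estimator hN (fun ω b => sampleCost (fun l => S (ω l)) b) (cost S)
      fun G => ?_
    have h := card_sampleCost_far_le hs S G (η := N * ε) (by positivity)
    have hs1 : (1 : ℝ) ≤ s := by exact_mod_cast hs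
    have hc := Finset.card_filter_add_card_filter_not (s := (Finset.univ : Finset (Fin s → X)))
      fun ω => |sampleCost (fun l => S (ω l)) (fun l => G (ω l)) - cost S G| ≤ N * ε
    rw [Finset.card_univ] at hc
    set F := (Finset.univ.filter fun ω : Fin s → X =>
      ¬ |sampleCost (fun l => S (ω l)) (fun l => G (ω l)) - cost S G| ≤ N * ε).card
    -- Since s ≥ 1, rounding the budget down loses at most a factor 2: Q < s + 1 ≤ 2 s.
    have h1 : 2 * (k : ℝ) ≤ s * (N * ε) ^ 2 := by
      have h2 : 1 ≤ N ^ 2 * L := by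
        rw [← haL, ← mul_pow]
        exact one_le_pow₀ hN1
      calc 2 * (k : ℝ) ≤ 600 * k * (N ^ 2 * L) := by nlinarith
        _ = Q * ε ^ 2 * N ^ 2 / 2 := by rw [hQε]; ring
        _ ≤ (2 * s) * ε ^ 2 * N ^ 2 / 2 := by gcongr; linarith
        _ = _ := by ring
    have h2 : (k : ℝ) * (F * 2) ≤ k * (Fintype.card (Fin s → X) : ℝ) := by
      have := mul_le_mul_of_nonneg_left h1 (Nat.cast_nonneg (α := ℝ) F)
      linarith
    have h3 : F * 2 ≤ Fintype.card (Fin s → X) := by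
      exact_mod_cast le_of_mul_le_mul_left h2 (by linarith)
    omega

end Seeding

theorem theorem2p2 :
    (∃ C : ℝ, 0 < C ∧
      ∀ (d : ℕ) (X : Finset (Seeding.Pt d)) [Nonempty X] (f : ℝ → Finset (Seeding.Pt d) → ℝ≥0)
        (k : ℕ) (_ : 0 < k) (ε : ℝ) (_ : 0 < ε) (m : ℕ) [NeZero m],
        C * (Seeding.zeta f X k : ℝ) * Real.log ((k : ℝ) / ε) ≤ (m : ℝ) →
        ∀ part : (Fin k → X) → X → Fin k, Seeding.IsNearestCenterRule part →
        ∀ G : X → Fin k,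
          |Seeding.expectedCost (Seeding.apxSeeding X f m k) part G -
            Seeding.expectedCost (Seeding.genericSeeding X f k) part G| ≤ ε) ∧
    (∃ C : ℝ, 0 < C ∧
      ∀ (d : ℕ) (X : Finset (Seeding.Pt d)) [Nonempty X] (k : ℕ) (_ : 0 < k)
        (ε' : ℝ) (_ : 0 < ε') (δ : ℝ) (_ : 0 < δ) (_ : δ < 1) (S' : X → Fin k),
        ∃ q : ℕ, (q : ℝ) ≤ C * (k : ℝ) * (ε' ^ 2)⁻¹ * Real.log (δ⁻¹) ∧
          ∃ A : Seeding.QueryEstimator X k q, ∀ G : X → Fin k,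
            1 - δ ≤ A.successProb G (Seeding.cost S' G) ε') := by
  refine ⟨⟨1, one_pos, fun d X _ f k hk ε hε m _ hm part _ G => ?_⟩,
    ⟨1200, by norm_num, fun d X _ k hk ε hε δ hδ hδ' S => ?_⟩⟩
  · rw [one_mul] at hm
    exact Seeding.abs_expectedCost_sub_le X f hk hε m hm part G
  -- For ε ≥ 1/2 the guess 1/2 needs no query. This is necessary because the budget tends to 0 as ε
  -- grows.
  · rcases le_total (1 / 2) ε with h | h
    · obtain ⟨A, hA⟩ := Seeding.exists_constant_estimator S h
      have hL : 0 ≤ Real.log δ⁻¹ := Real.log_nonneg ((one_le_inv₀ hδ).2 hδ'.le)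
      exact ⟨0, by rw [Nat.cast_zero]; positivity, A, fun G => by linarith [hA G]⟩
    · rcases le_total (1 / 16) (Real.log δ⁻¹) with hL | hL
      · exact Seeding.exists_estimator_of_le_log hk hε (by linarith) hδ hL S
      · exact Seeding.exists_estimator_of_log_le hk hε hδ hδ' hL S
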